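/- Let $\mathbf{F}_q$ be a finite field with $q$ elements and $V$ a nonempty finite set with $n$ elements. A \emph{graph} on $V$ is a symmetric matrix $G=(g_{vw})_{v,w\in V}$ over $\mathbf{F}_q$ with zero diagonal. For $r\in\mathbf{F}_q$ and $v\in V$ let $G*_r v$ be the graph $G'$ with $g'_{uw}=g_{uw}+r\,g_{vu}g_{vw}$ for distinct $u,w\in V\setminus\{v\}$ and $g'_{vw}=g_{vw}$ for all $w$; for $0\neq s\in\mathbf{F}_q$ let $G\circ_s v$ be the graph obtained from $G$ by multiplying all labels $g_{vw}=g_{wv}$ ($w\in V$) by $s$. Two graphs are \emph{locally equivalent} if a finite sequence of these operations leads from one to the other; $l(G)$ denotes the number of graphs locally equivalent to $G$. Let $\mathbf{K}=\mathbf{F}_q^2$ with the form $\langle(x,y),(x',y')\rangle=xy'-x'y$, and let $\mathbf{K}^V$ carry the form $\langle A,B\rangle=\sum_{v\in V}\langle A(v),B(v)\rangle$. For $A\in\mathbf{K}^V$ and $v\in V$ let $A_v\in\mathbf{K}^V$ agree with $A$ at $v$ and vanish elsewhere. An \emph{isotropic system} is an $n$-dimensional subspace $\mathcal{L}\subseteq\mathbf{K}^V$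 with $\langle A,B\rangle=0$ for all $A,B\in\mathcal{L}$. A triple $(G,A,B)$, with $G$ a graph on $V$ and $A,B\in\mathbf{K}^V$, is a \emph{graphic presentation} of $\mathcal{L}$ if there is a nonzero $c\in\mathbf{F}_q$ with $\langle B(v),A(v)\rangle=c$ for all $v\in V$ and the vectors $B_v+\sum_{w\in V}g_{vw}A_w$ ($v\in V$) form a basis of $\mathcal{L}$; then $G$ is a \emph{fundamental graph} of $\mathcal{L}$. An \emph{Eulerian vector} of $\mathcal{L}$ is a vector $A\in\mathbf{K}^V$ with $A(v)\neq 0$ for all $v$ and $\operatorname{span}\{A_v: v\in V\}\cap\mathcal{L}=0$; let $\epsilon(\mathcal{L})$ be the number of Eulerian vectors of $\mathcal{L}$. \textbf{Theorem.} Let $\mathcal{L}$ be an isotropic system with fundamental graph $G$. The number of pairs $(A,B)$ such that $(H,A,B)$ is a graphic presentation of $\mathcal{L}$ is positive and is the same for every fundamental graph $H$ of $\mathcal{L}$; denote it by $\lambda(\mathcal{L})$. Then the number of graphs that are locally equivalent to $cG$ for some nonzero $c\in\mathbf{F}_q$ equals $$\frac{(q-1)\,\epsilon(\mathcal{L})}{\lambda(\mathcal{L})},$$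 and either $l(G)$ or $2\,l(G)$ is equal to this quantity. -/

import Mathlib

namespace IsoSys

variable {V F : Type*} [Field F]

/-- A simple graph on `V` with edges labeled by elements of `F` (label `0` means no edge),
i.e. a symmetric matrix with zero diagonal. -/
@[ext]
structure LabeledGraph (V F : Type*) [Field F] where
  label : Matrix V V F
  symm : ∀ v w, label v w = label w v
  diag : ∀ v, label v v = 0

namespace LabeledGraph

/-- The operation `G *_r v`: labels `g u w` with `u`, `w`, `v` distinct are replaced by
`g u w + r * g v u * g v w`; the other labels are kept. -/
def localComp [DecidableEq V] (G : LabeledGraph V F) (r : F) (v : V) : LabeledGraph V F where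
  label := fun u w =>
    if u = v ∨ w = v ∨ u = w then G.label u w
    else G.label u w + r * G.label v u * G.label v w
  symm := by
    intro u w
    have h : (u = v ∨ w = v ∨ u = w) ↔ (w = v ∨ u = v ∨ w = u) := by
      constructor <;> rintro (h | h | h) <;> simp [h]
    simp only [h, G.symm u w]
    split_ifs
    · rfl
    · ring
  diag := by
    intro u
    simp [G.diag u]

/-- The operation `G ∘_s v`: the labels of the edges at `v` are multiplied by `s`. -/
def scaleVertex [DecidableEq V] (G : LabeledGraph V F) (s : F) (v : V) : LabeledGraph V F where
  label := fun u w => if u = v ∨ w = v then s * G.label u w else G.label u w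
  symm := by
    intro u w
    simp only [G.symm u w, or_comm (a := u = v)]
  diag := by
    intro u
    simp [G.diag u]

/-- The graph `cG`, all of whose labels are multiplied by `c`. -/
def scale (c : F) (G : LabeledGraph V F) : LabeledGraph V F where
  label := c • G.label
  symm := by
    intro u w
    simp [G.symm u w]
  diag := by
    intro u
    simp [G.diag u]

/-- One local operation leads from `G` to `H`. -/
def LocalStep [DecidableEq V] (G H : LabeledGraph V F) : Prop :=
  (∃ (r : F) (v : V), H = G.localComp r v) ∨
    (∃ (s : F) (v : V), s ≠ 0 ∧ H = G.scaleVertex s v)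

/-- `G` and `H` are locally equivalent: a finite sequence of local operations leads
from `G` to `H`. -/
def LocallyEquivalent [DecidableEq V] (G H : LabeledGraph V F) : Prop :=
  Relation.ReflTransGen LocalStep G H

/-- `l(G)`, the number of graphs that are locally equivalent to `G`. -/
noncomputable def numLocallyEquivalent [DecidableEq V] (G : LabeledGraph V F) : ℕ :=
  Nat.card {H : LabeledGraph V F // LocallyEquivalent G H}

/-- The number of graphs that are locally equivalent to `cG` for some nonzero `c`. -/
noncomputable def numLocallyEquivalentToMultiple [DecidableEq V] (G : LabeledGraph V F) : ℕ :=
  Nat.card {H : LabeledGraph V F // ∃ c : F, c ≠ 0 ∧ LocallyEquivalent (G.scale c) H}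

end LabeledGraph

/-- The bilinear form `⟨(x, y), (x', y')⟩ = x y' - x' y` on `K = F × F`. -/
def pairing (a b : F × F) : F := a.1 * b.2 - b.1 * a.2

/-- The induced bilinear form on `K ^ V`. -/
def form [Fintype V] (A B : V → F × F) : F := ∑ v, pairing (A v) (B v)

/-- An isotropic system: a subspace of `K ^ V` of dimension `|V|` that is orthogonal to
itself. -/
structure IsIsotropicSystem [Fintype V] (L : Submodule F (V → F × F)) : Prop where
  finrank_eq : Module.finrank F L = Fintype.card V
  isotropic : ∀ A ∈ L, ∀ B ∈ L, form A B = 0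

/-- The `v`-th row `g(v) × A + B_v` of the matrix `(I | G) D(A, B)`, as a vector of `K ^ V`. -/
def presentationRow [DecidableEq V] (G : LabeledGraph V F) (A B : V → F × F) (v : V) :
    V → F × F :=
  (fun w => G.label v w • A w) + Pi.single v (B v)

/-- `(G, A, B)` is a graphic presentation of `L`: with `A = (X, Y)` and `B = (Z, T)`, the
diagonal matrix `det D(A, B)`, whose entries are `Z v * Y v - X v * T v`, is a nonzero multiple
of the identity, and the rows of `(I | G) D(A, B)` form a basis of `L`. -/
structure IsGraphicPresentation [DecidableEq V] (L : Submodule F (V → F × F))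
    (G : LabeledGraph V F) (A B : V → F × F) : Prop where
  det_const : ∃ c : F, c ≠ 0 ∧ ∀ v, pairing (B v) (A v) = c
  linearIndependent : LinearIndependent F (presentationRow G A B)
  span_eq : Submodule.span F (Set.range (presentationRow G A B)) = L

/-- `G` is a fundamental graph of `L`. -/
def IsFundamentalGraph [DecidableEq V] (L : Submodule F (V → F × F))
    (G : LabeledGraph V F) : Prop :=
  ∃ A B, IsGraphicPresentation L G A B

/-- The number of pairs `(A, B)` such that `(G, A, B)` is a graphic presentation of `L`. -/
noncomputable def numPresentations [DecidableEq V] (L : Submodule F (V → F × F))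
    (G : LabeledGraph V F) : ℕ :=
  Nat.card {P : (V → F × F) × (V → F × F) // IsGraphicPresentation L G P.1 P.2}

open Classical in
/-- The index `λ(L)`: the number of pairs `(A, B)` such that `(G, A, B)` is a graphic
presentation of `L`, where `G` is a fundamental graph of `L`. That the choice of `G` does not
matter is a claim about `L`, which is not built into this definition. -/
noncomputable def index [DecidableEq V] (L : Submodule F (V → F × F)) : ℕ :=
  if h : ∃ G : LabeledGraph V F, IsFundamentalGraph L G then numPresentations L h.choose else 0

/-- `A` is an Eulerian vector for `L`: it is complete (all its coordinates are nonzero), and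
the span of the vectors `A_v` meets `L` only in `0`. -/
structure IsEulerianVector [DecidableEq V] (L : Submodule F (V → F × F))
    (A : V → F × F) : Prop where
  complete : ∀ v, A v ≠ 0
  disjoint : Submodule.span F (Set.range fun v => (Pi.single v (A v) : V → F × F)) ⊓ L = ⊥

/-- `ε(L)`, the number of Eulerian vectors for `L`. -/
noncomputable def numEulerianVectors [DecidableEq V] (L : Submodule F (V → F × F)) : ℕ :=
  Nat.card {A : V → F × F // IsEulerianVector L A}

end IsoSys

namespace IsoSys

variable {V F : Type*} [Field F]

/-! ### The symplectic plane -/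

/-! Count the presentations `(H, A, B)` of `L` in two ways. If `A` is Eulerian, `L` is a complement
of the span of the `A_v`. So for each nonzero `c` there is exactly one pair `(H, B)` with
determinant `c`: decomposing vectors along the complement gives the rows, and isotropy makes the
matrix symmetric (`Presents.unique`, `IsEulerianVector.exists_presents`). This gives `(q - 1) *
ε(L)` presentations. On the other side, local operations and scalings lift to injections between
sets of presentations, and presentations with equal determinant have locally equivalent graphs
(`Presents.locallyEquivalent`). Hence the fundamental graphs are exactly those locally equivalent to
multiples of `G`, and each has equally many presentations. Scaling by a square is a local
equivalence and the nonzero squares have index at most two, so the multiples of `G` meet one class,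
or two classes of equal size. -/

lemma pairing_self (a : F × F) : pairing a a = 0 := by simp [pairing]

lemma pairing_swap (a b : F × F) : pairing a b = -pairing b a := by simp [pairing]

lemma pairing_add_left (a b c : F × F) : pairing (a + b) c = pairing a c + pairing b c := by
  simp only [pairing, Prod.fst_add, Prod.snd_add]; ring

lemma pairing_add_right (a b c : F × F) : pairing a (b + c) = pairing a b + pairing a c := by
  simp only [pairing, Prod.fst_add, Prod.snd_add]; ring

lemma pairing_sub_left (a b c : F × F) : pairing (a - b) c = pairing a c - pairing b c := by
  simp only [pairing, Prod.fst_sub, Prod.snd_sub]; ring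

lemma pairing_smul_left (r : F) (a b : F × F) : pairing (r • a) b = r * pairing a b := by
  simp only [pairing, Prod.smul_fst, Prod.smul_snd, smul_eq_mul]; ring

lemma pairing_smul_right (r : F) (a b : F × F) : pairing a (r • b) = r * pairing a b := by
  simp only [pairing, Prod.smul_fst, Prod.smul_snd, smul_eq_mul]; ring

lemma pairing_zero_left (a : F × F) : pairing 0 a = 0 := by simp [pairing]

lemma pairing_zero_right (a : F × F) : pairing a 0 = 0 := by simp [pairing]

lemma exists_smul_eq_of_pairing_eq_zero {a b : F × F} (h : pairing a b = 0) (hb : b ≠ 0) :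
    ∃ t : F, a = t • b := by
  obtain ⟨a₁, a₂⟩ := a
  obtain ⟨b₁, b₂⟩ := b
  simp only [pairing] at h
  by_cases h₁ : b₁ = 0
  · have h₂ : b₂ ≠ 0 := fun h₂ => hb (by simp [h₁, h₂])
    refine ⟨a₂ / b₂, ?_⟩
    have : a₁ = 0 := by simpa [h₁, h₂] using h
    ext <;> simp [h₁, h₂, this]
  · refine ⟨a₁ / b₁, ?_⟩
    ext
    · simp [h₁]
    · simp only [Prod.smul_mk, smul_eq_mul]
      field_simp
      linear_combination -h

lemma exists_pairing_eq {a : F × F} (ha : a ≠ 0) (c : F) : ∃ b, pairing b a = c := by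
  obtain ⟨a₁, a₂⟩ := a
  by_cases h₁ : a₁ = 0
  · have h₂ : a₂ ≠ 0 := fun h₂ => ha (by simp [h₁, h₂])
    exact ⟨(c / a₂, 0), by simp [pairing, h₂]⟩
  · exact ⟨(0, -c / a₁), by simp only [pairing]; field_simp; ring⟩

lemma exists_eq_smul_add_smul {a b x : F × F} (h : pairing b a ≠ 0) (hx : pairing b x ≠ 0) :
    ∃ r : F, x = (pairing b x / pairing b a) • (a + r • b) := by
  refine ⟨-pairing a x / pairing b x, ?_⟩
  -- Cramer's rule in the plane.
  have key : pairing b a • x = pairing b x • a - pairing a x • b := by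
    ext <;> simp only [pairing, Prod.smul_fst, Prod.smul_snd, Prod.fst_sub, Prod.snd_sub,
      smul_eq_mul] <;> ring
  rw [smul_add, smul_smul, div_mul_div_comm, mul_comm (pairing b x) (-_),
    mul_div_mul_right _ _ hx, div_eq_inv_mul, div_eq_inv_mul, mul_smul, mul_smul, ← smul_add,
    neg_smul, ← sub_eq_add_neg, ← key, inv_smul_smul₀ h]

lemma isSquare_mul_of_not_isSquare [Finite F] {a b : F} (ha : ¬ IsSquare a)
    (hb : ¬ IsSquare b) : IsSquare (a * b) := by
  classical
  have := Fintype.ofFinite F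
  by_contra h
  rw [← quadraticChar_neg_one_iff_not_isSquare] at ha hb h
  rw [map_mul, ha, hb] at h
  norm_num at h

/-! ### Local equivalence of graphs -/

namespace LabeledGraph

lemma localComp_neg_localComp [DecidableEq V] (G : LabeledGraph V F) (r : F) (v : V) :
    (G.localComp r v).localComp (-r) v = G := by
  ext u w
  by_cases h : u = v ∨ w = v ∨ u = w <;> simp [localComp, h]

lemma scaleVertex_inv_scaleVertex [DecidableEq V] (G : LabeledGraph V F) {s : F} (hs : s ≠ 0)
    (v : V) : (G.scaleVertex s v).scaleVertex s⁻¹ v = G := by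
  ext u w
  by_cases h : u = v ∨ w = v <;> simp [scaleVertex, h, hs]

lemma label_scale (c : F) (G : LabeledGraph V F) (v w : V) :
    (G.scale c).label v w = c * G.label v w := rfl

lemma scale_scale (c d : F) (G : LabeledGraph V F) : (G.scale d).scale c = G.scale (c * d) := by
  ext u w
  simp [scale, mul_assoc]

lemma scale_one (G : LabeledGraph V F) : G.scale 1 = G := by
  ext u w
  simp [scale]

variable [DecidableEq V]

lemma LocalStep.symm {G H : LabeledGraph V F} (h : LocalStep G H) : LocalStep H G := by
  rcases h with ⟨r, v, rfl⟩ | ⟨s, v, hs, rfl⟩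
  · exact Or.inl ⟨-r, v, (localComp_neg_localComp G r v).symm⟩
  · exact Or.inr ⟨s⁻¹, v, inv_ne_zero hs, (scaleVertex_inv_scaleVertex G hs v).symm⟩

lemma LocallyEquivalent.symm {G H : LabeledGraph V F} (h : LocallyEquivalent G H) :
    LocallyEquivalent H G := by
  induction h with
  | refl => exact .refl
  | tail _ h ih => exact .head h.symm ih

lemma LocallyEquivalent.trans {G H K : LabeledGraph V F} (h : LocallyEquivalent G H)
    (h' : LocallyEquivalent H K) : LocallyEquivalent G K :=
  Relation.ReflTransGen.trans h h'

lemma locallyEquivalent_localComp (G : LabeledGraph V F) (r : F) (v : V) :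
    LocallyEquivalent G (G.localComp r v) :=
  .single (Or.inl ⟨r, v, rfl⟩)

lemma locallyEquivalent_scaleVertex (G : LabeledGraph V F) {s : F} (hs : s ≠ 0) (v : V) :
    LocallyEquivalent G (G.scaleVertex s v) :=
  .single (Or.inr ⟨s, v, hs, rfl⟩)

lemma LocallyEquivalent.scale {G H : LabeledGraph V F} {c : F} (hc : c ≠ 0)
    (h : LocallyEquivalent G H) : LocallyEquivalent (G.scale c) (H.scale c) := by
  refine Relation.ReflTransGen.lift (fun K => K.scale c) ?_ _ _ h
  rintro K _ (⟨r, v, rfl⟩ | ⟨s, v, hs, rfl⟩)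
  -- The correction term is quadratic in the labels and so gains `c ^ 2`; dividing `r` by `c`
  -- restores homogeneity.
  · refine Or.inl ⟨r / c, v, ?_⟩
    ext u w
    by_cases h : u = v ∨ w = v ∨ u = w
    · simp [localComp, label_scale, h]
    · simp only [localComp, label_scale, h, if_false]
      field_simp
  · refine Or.inr ⟨s, v, hs, ?_⟩
    ext u w
    by_cases h : u = v ∨ w = v
    · simp only [scaleVertex, label_scale, h, if_true]
      ring
    · simp [scaleVertex, label_scale, h]

/-- Scaling every vertex by `s` multiplies all labels by `s ^ 2`. -/
lemma locallyEquivalent_scale_sq [Fintype V] (G : LabeledGraph V F) {s : F} (hs : s ≠ 0) :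
    LocallyEquivalent G (G.scale (s * s)) := by
  -- An entry gains one factor `s` per endpoint in `S`. Diagonal entries, which `scaleVertex` scales
  -- only once, are zero.
  have key : ∀ S : Finset V, ∃ H : LabeledGraph V F, LocallyEquivalent G H ∧ ∀ u w,
      H.label u w = (if u ∈ S then s else 1) * (if w ∈ S then s else 1) * G.label u w := by
    intro S
    induction S using Finset.induction_on with
    | empty => exact ⟨G, .refl, by simp⟩
    | insert v S hv ih =>
      obtain ⟨H, hH, h⟩ := ih
      refine ⟨H.scaleVertex s v, hH.trans (locallyEquivalent_scaleVertex H hs v), fun u w => ?_⟩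
      by_cases hu : u = v <;> by_cases hw : w = v
      · simp [scaleVertex, hu, hw, diag]
      · simp [scaleVertex, hu, hw, h, hv, mul_assoc]
      · simp only [scaleVertex, hu, hw, h, hv, Finset.mem_insert]
        simp
        ring_nf
      · simp [scaleVertex, hu, hw, h]
  obtain ⟨H, hH, h⟩ := key Finset.univ
  have : H = G.scale (s * s) := by
    ext u w
    simp [h, LabeledGraph.scale]
  exact this ▸ hH

instance [Finite V] [Finite F] : Finite (LabeledGraph V F) :=
  Finite.of_injective (fun G v w => G.label v w) fun G H h => by
    ext u w
    exact congrFun (congrFun h u) w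

/-- The multiples of `G` fall into at most two classes of local equivalence, of equal size. -/
lemma numLocallyEquivalentToMultiple_eq [Fintype V] [Finite F] (G : LabeledGraph V F) :
    G.numLocallyEquivalent = G.numLocallyEquivalentToMultiple ∨
      2 * G.numLocallyEquivalent = G.numLocallyEquivalentToMultiple := by
  by_cases hall : ∀ c : F, c ≠ 0 → LocallyEquivalent G (G.scale c)
  · refine Or.inl (Nat.card_congr (Equiv.subtypeEquivRight fun H => ⟨fun h => ?_, ?_⟩))
    · exact ⟨1, one_ne_zero, by rwa [scale_one]⟩
    · rintro ⟨c, hc, h⟩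
      exact (hall c hc).trans h
  · push Not at hall
    obtain ⟨d, hd, hGd⟩ := hall
    have hnsq : ∀ c : F, c ≠ 0 → ¬ LocallyEquivalent G (G.scale c) → ¬ IsSquare c := by
      rintro _ hc h ⟨s, rfl⟩
      exact h (locallyEquivalent_scale_sq G (left_ne_zero_of_mul hc))
    have hclass : ∀ c : F, c ≠ 0 → LocallyEquivalent G (G.scale c) ∨
        LocallyEquivalent (G.scale d) (G.scale c) := by
      intro c hc
      by_contra! h
      obtain ⟨s, hs⟩ := isSquare_mul_of_not_isSquare (hnsq c hc h.1) (hnsq d hd hGd)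
      have hs0 : s ≠ 0 := by
        rintro rfl
        simp [hc, hd] at hs
      -- Since `c * d = s * s`, the scalars `c` and `d` differ by the square of `s / d`.
      have := locallyEquivalent_scale_sq (G.scale d) (s := s / d) (div_ne_zero hs0 hd)
      rw [scale_scale] at this
      have e : s / d * (s / d) * d = c := by
        field_simp
        rw [pow_two, ← hs, mul_comm]
      exact h.2 (e ▸ this)
    let S : Set (LabeledGraph V F) := {H | LocallyEquivalent G H}
    let T : Set (LabeledGraph V F) := {H | LocallyEquivalent (G.scale d) H}
    have hdisj : Disjoint S T := Set.disjoint_left.2 fun H hS hT =>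
      hGd (LocallyEquivalent.trans hS (LocallyEquivalent.symm hT))
    have hT : T = (fun H => H.scale d) '' S := by
      ext H
      refine ⟨fun h => ⟨H.scale d⁻¹, ?_, ?_⟩, ?_⟩
      · have := LocallyEquivalent.scale (inv_ne_zero hd) h
        rwa [scale_scale, inv_mul_cancel₀ hd, scale_one] at this
      · simp [scale_scale, hd, scale_one]
      · rintro ⟨K, hK, rfl⟩
        exact LocallyEquivalent.scale hd hK
    have hinj : Function.Injective (fun H : LabeledGraph V F => H.scale d) := by
      intro H K h
      have := congrArg (fun H : LabeledGraph V F => H.scale d⁻¹) h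
      simpa [scale_scale, hd, scale_one] using this
    have hU : {H : LabeledGraph V F | ∃ c : F, c ≠ 0 ∧ LocallyEquivalent (G.scale c) H}
        = S ∪ T := by
      ext H
      constructor
      · rintro ⟨c, hc, h⟩
        exact (hclass c hc).imp (·.trans h) (·.trans h)
      · rintro (h | h)
        · exact ⟨1, one_ne_zero, by rwa [scale_one]⟩
        · exact ⟨d, hd, h⟩
    right
    change 2 * Set.ncard S = Set.ncard
      {H : LabeledGraph V F | ∃ c : F, c ≠ 0 ∧ LocallyEquivalent (G.scale c) H}
    rw [hU, Set.ncard_union_eq hdisj, hT, Set.ncard_image_of_injective _ hinj, two_mul]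

end LabeledGraph

/-! ### Graphic presentations with a given determinant -/

variable [DecidableEq V]

lemma presentationRow_self (G : LabeledGraph V F) (A B : V → F × F) (v : V) :
    presentationRow G A B v v = B v := by
  simp [presentationRow, G.diag]

lemma presentationRow_of_ne (G : LabeledGraph V F) (A B : V → F × F) {v w : V} (h : w ≠ v) :
    presentationRow G A B v w = G.label v w • A w := by
  simp [presentationRow, h]

/-- The pairing of a row with a vector of the form `(a v • A v)`. -/
lemma form_presentationRow [Fintype V] (G : LabeledGraph V F) (A B : V → F × F) (v : V)
    (a : V → F) :
    form (presentationRow G A B v) (fun w => a w • A w) = a v * pairing (B v) (A v) := by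
  rw [form, Finset.sum_eq_single v]
  · rw [presentationRow_self, pairing_smul_right]
  · intro w _ hw
    simp [presentationRow_of_ne G A B hw, pairing_smul_left, pairing_smul_right, pairing_self]
  · simp

lemma mem_span_single_iff [Fintype V] (A x : V → F × F) :
    x ∈ Submodule.span F (Set.range fun v => (Pi.single v (A v) : V → F × F)) ↔
      ∃ a : V → F, x = fun v => a v • A v := by
  rw [Submodule.mem_span_range_iff_exists_fun]
  refine exists_congr fun a => ?_
  have : ∑ i, a i • (Pi.single i (A i) : V → F × F) = fun v => a v • A v := by
    ext1 w
    rw [Finset.sum_apply, Finset.sum_eq_single w]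
    · simp
    · intro u _ hu
      simp [hu.symm]
    · simp
  rw [this, eq_comm]

/-- `(G, A, B)` has constant nonzero determinant `c` and its rows belong to `L`. -/
structure Presents (L : Submodule F (V → F × F)) (c : F) (G : LabeledGraph V F)
    (A B : V → F × F) : Prop where
  ne_zero : c ≠ 0
  pairing_eq : ∀ v, pairing (B v) (A v) = c
  row_mem : ∀ v, presentationRow G A B v ∈ L

variable {L : Submodule F (V → F × F)} {c : F} {G H : LabeledGraph V F} {A B A' B' : V → F × F}

/-- At coordinate `v` every row but the `v`-th is a multiple of `A v`, so pairing with `A v`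
isolates the coefficient of row `v`. -/
lemma Presents.linearIndependent [Fintype V] (h : Presents L c G A B) :
    LinearIndependent F (presentationRow G A B) := by
  rw [Fintype.linearIndependent_iff]
  intro x hx v
  have hv : pairing ((∑ w, x w • presentationRow G A B w) v) (A v) = 0 := by
    rw [hx]
    exact pairing_zero_left _
  have e : (∑ w, x w • presentationRow G A B w) v =
      x v • B v + (∑ w ∈ Finset.univ.erase v, x w * G.label w v) • A v := by
    rw [Finset.sum_apply, ← Finset.add_sum_erase _ _ (Finset.mem_univ v), Finset.sum_smul]
    congr 1
    · rw [Pi.smul_apply, presentationRow_self]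
    · refine Finset.sum_congr rfl fun w hw => ?_
      rw [Pi.smul_apply, presentationRow_of_ne G A B (Finset.ne_of_mem_erase hw).symm, smul_smul]
  rw [e, pairing_add_left, pairing_smul_left, pairing_smul_left, pairing_self, h.pairing_eq] at hv
  simpa [h.ne_zero] using hv

/-- Independence is automatic and `L` has dimension `|V|`, so membership of the rows in `L`
suffices. -/
lemma isGraphicPresentation_iff [Fintype V] (hL : IsIsotropicSystem L) :
    IsGraphicPresentation L G A B ↔ ∃ c, Presents L c G A B := by
  constructor
  · rintro ⟨⟨c, hc, h⟩, -, hs⟩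
    exact ⟨c, hc, h, fun v => hs ▸ Submodule.subset_span ⟨v, rfl⟩⟩
  · rintro ⟨c, h⟩
    refine ⟨⟨c, h.ne_zero, h.pairing_eq⟩, h.linearIndependent, ?_⟩
    apply Submodule.eq_of_le_of_finrank_eq
    · rw [Submodule.span_le]
      rintro _ ⟨v, rfl⟩
      exact h.row_mem v
    · rw [finrank_span_eq_card h.linearIndependent, hL.finrank_eq]

lemma Presents.isEulerianVector [Fintype V] (hL : IsIsotropicSystem L) (h : Presents L c G A B) :
    IsEulerianVector L A := by
  refine ⟨fun v hv => h.ne_zero ?_, (Submodule.eq_bot_iff _).2 ?_⟩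
  · rw [← h.pairing_eq v, hv, pairing_zero_right]
  · rintro x ⟨hx, hxL⟩
    obtain ⟨a, rfl⟩ := (mem_span_single_iff A x).1 hx
    ext1 v
    have := hL.isotropic _ (h.row_mem v) _ hxL
    rw [form_presentationRow, h.pairing_eq] at this
    simp [(mul_eq_zero.1 this).resolve_right h.ne_zero]

/-- In the plane, orthogonal to `A v` means parallel to `A v`, so `x` lies in the span of the `A_v`.
-/
lemma IsEulerianVector.eq_zero [Fintype V] (hA : IsEulerianVector L A) {x : V → F × F}
    (hx : x ∈ L) (h : ∀ v, pairing (x v) (A v) = 0) : x = 0 := by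
  rw [← Submodule.mem_bot F, ← hA.disjoint]
  refine ⟨(mem_span_single_iff A x).2 ?_, hx⟩
  choose a ha using fun v => exists_smul_eq_of_pairing_eq_zero (h v) (hA.complete v)
  exact ⟨a, funext ha⟩

lemma Presents.unique [Fintype V] (hL : IsIsotropicSystem L) (h : Presents L c G A B)
    (h' : Presents L c H A B') : G = H ∧ B = B' := by
  have hA := h.isEulerianVector hL
  have key : ∀ v, presentationRow G A B v = presentationRow H A B' v := by
    intro v
    rw [← sub_eq_zero]
    refine hA.eq_zero (L.sub_mem (h.row_mem v) (h'.row_mem v)) fun w => ?_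
    rw [Pi.sub_apply, pairing_sub_left]
    by_cases hw : w = v
    · subst hw
      rw [presentationRow_self, presentationRow_self, h.pairing_eq, h'.pairing_eq, sub_self]
    · simp [presentationRow_of_ne _ _ _ hw, pairing_smul_left, pairing_self]
  constructor
  · ext v w
    by_cases hw : w = v
    · rw [hw, G.diag, H.diag]
    · have := congrFun (key v) w
      rw [presentationRow_of_ne _ _ _ hw, presentationRow_of_ne _ _ _ hw] at this
      exact smul_left_injective F (hA.complete w) this
  · ext1 v
    simpa [presentationRow_self] using congrFun (key v) v

/-- Two subspaces of dimension `|V|` with zero intersection fill a space of dimension `2 * |V|`. -/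
lemma IsEulerianVector.sup_eq_top [Fintype V] (hL : IsIsotropicSystem L)
    (hA : IsEulerianVector L A) :
    Submodule.span F (Set.range fun v => (Pi.single v (A v) : V → F × F)) ⊔ L = ⊤ := by
  have hli : LinearIndependent F (fun v => (Pi.single v (A v) : V → F × F)) := by
    rw [Fintype.linearIndependent_iff]
    intro x hx v
    have := congrFun hx v
    rw [Finset.sum_apply, Finset.sum_eq_single v] at this
    · simpa [hA.complete v] using this
    · intro u _ hu
      simp [hu.symm]
    · simp
  apply Submodule.eq_top_of_finrank_eq
  have := Submodule.finrank_sup_add_finrank_inf_eq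
    (Submodule.span F (Set.range fun v => (Pi.single v (A v) : V → F × F))) L
  rw [hA.disjoint, finrank_bot, finrank_span_eq_card hli, hL.finrank_eq] at this
  rw [Module.finrank_pi_fintype]
  simp only [Module.finrank_prod, Module.finrank_self, Finset.sum_const, Finset.card_univ,
    smul_eq_mul]
  omega

lemma IsEulerianVector.exists_presents [Fintype V] (hL : IsIsotropicSystem L)
    (hA : IsEulerianVector L A) (hc : c ≠ 0) : ∃ G B, Presents L c G A B := by
  choose B₀ hB₀ using fun v => exists_pairing_eq (hA.complete v) c
  have hex : ∀ v, ∃ m : V → F, (fun w => m w • A w) + Pi.single v (B₀ v) ∈ L := by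
    intro v
    have : (Pi.single v (B₀ v) : V → F × F) ∈
        Submodule.span F (Set.range fun v => (Pi.single v (A v) : V → F × F)) ⊔ L := by
      rw [hA.sup_eq_top hL]
      trivial
    obtain ⟨y, hy, z, hz, e⟩ := Submodule.mem_sup.1 this
    obtain ⟨a, rfl⟩ := (mem_span_single_iff A y).1 hy
    refine ⟨fun w => -a w, ?_⟩
    rw [← e]
    convert hz using 1
    ext1 w
    simp
  choose m hm using hex
  -- Vectors `v` and `w` pair nontrivially only at the coordinates `v` and `w`; isotropy then
  -- equates the two entries, up to the factor `c`.
  have hsymm : ∀ v w, m v w = m w v := by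
    intro v w
    by_cases hvw : v = w
    · rw [hvw]
    have := hL.isotropic _ (hm v) _ (hm w)
    rw [form, ← Finset.add_sum_erase _ _ (Finset.mem_univ v),
      ← Finset.add_sum_erase _ _ (Finset.mem_erase.2 ⟨Ne.symm hvw, Finset.mem_univ w⟩),
      Finset.sum_eq_zero] at this
    · simp only [Pi.add_apply, Pi.single_eq_same, Pi.single_eq_of_ne hvw,
        Pi.single_eq_of_ne (Ne.symm hvw), add_zero, pairing_add_left, pairing_add_right,
        pairing_smul_left, pairing_smul_right, pairing_self, hB₀, pairing_swap (A w) (B₀ w)] at this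
      refine mul_right_cancel₀ hc ?_
      linear_combination -this
    · intro u hu
      simp only [Finset.mem_erase] at hu
      simp [Pi.single_eq_of_ne hu.1, Pi.single_eq_of_ne hu.2.1, pairing_smul_left,
        pairing_smul_right, pairing_self]
  -- The diagonal of `m` is absorbed into `B`, which leaves the pairings with `A` unchanged.
  refine ⟨⟨fun v w => if v = w then 0 else m v w, ?_, by simp⟩, fun v => B₀ v + m v v • A v, hc,
    ?_, ?_⟩
  · intro v w
    simp only [eq_comm (a := v), hsymm v w]
  · intro v
    rw [pairing_add_left, pairing_smul_left, pairing_self, hB₀, mul_zero, add_zero]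
  · intro v
    convert hm v using 1
    ext1 w
    by_cases hw : w = v
    · subst hw
      simp [presentationRow, add_comm]
    · simp [presentationRow, hw, Ne.symm hw]

/-! ### Local operations on presentations -/

lemma Presents.scale (h : Presents L c G A B) {d : F} (hd : d ≠ 0) :
    Presents L (d * c) (G.scale d) A (d • B) := by
  refine ⟨mul_ne_zero hd h.ne_zero, fun v => ?_, fun v => ?_⟩
  · rw [Pi.smul_apply, pairing_smul_left, h.pairing_eq]
  · convert L.smul_mem d (h.row_mem v) using 1
    ext1 w
    by_cases hw : w = v
    · subst hw
      simp [presentationRow_self]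
    · simp [presentationRow_of_ne _ _ _ hw, LabeledGraph.scale, smul_smul]

lemma Presents.scaleVertex (h : Presents L c G A B) {s : F} (hs : s ≠ 0) (v : V) :
    Presents L c (G.scaleVertex s v) (Function.update A v (s⁻¹ • A v))
      (Function.update B v (s • B v)) := by
  refine ⟨h.ne_zero, fun u => ?_, fun u => ?_⟩
  · by_cases hu : u = v
    · subst hu
      simp [pairing_smul_left, pairing_smul_right, h.pairing_eq, hs]
    · simp [hu, h.pairing_eq]
  · convert L.smul_mem (if u = v then s else 1) (h.row_mem u) using 1
    ext1 w
    by_cases hw : w = u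
    · subst hw
      by_cases hu : w = v
      · subst hu
        simp [presentationRow_self]
      · simp [presentationRow_self, hu]
    · rw [Pi.smul_apply, presentationRow_of_ne _ _ _ hw, presentationRow_of_ne _ _ _ hw]
      by_cases hu : u = v
      · subst hu
        simp [LabeledGraph.scaleVertex, hw, smul_smul]
      · by_cases hwv : w = v
        · subst hwv
          simp only [LabeledGraph.scaleVertex, hu, or_true, if_true, if_false,
            Function.update_self, smul_smul]
          congr 1
          field_simp
        · simp [LabeledGraph.scaleVertex, hu, hwv]

/-- The new row `u` is the old one plus `r * G.label v u` times row `v`; the changes to `A v` and `B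
u` absorb the terms this creates at `v` and `u`. -/
lemma Presents.localComp (h : Presents L c G A B) (r : F) (v : V) :
    Presents L c (G.localComp r v) (Function.update A v (A v + r • B v))
      (fun u => B u + (r * G.label v u ^ 2) • A u) := by
  refine ⟨h.ne_zero, fun u => ?_, fun u => ?_⟩
  · by_cases hu : u = v
    · subst hu
      simp [pairing_add_right, pairing_smul_right, h.pairing_eq, G.diag, pairing_self]
    · simp [hu, h.pairing_eq, pairing_add_left, pairing_smul_left, pairing_self]
  · convert L.add_mem (h.row_mem u) (L.smul_mem (r * G.label v u) (h.row_mem v)) using 1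
    ext1 w
    rw [Pi.add_apply, Pi.smul_apply]
    by_cases hw : w = u
    · subst hw
      by_cases hu : w = v
      · subst hu
        simp [presentationRow_self, G.diag]
      · rw [presentationRow_self, presentationRow_self, presentationRow_of_ne _ _ _ hu, smul_smul]
        ring_nf
    · rw [presentationRow_of_ne _ _ _ hw, presentationRow_of_ne _ _ _ hw]
      by_cases hu : u = v
      · subst hu
        simp [LabeledGraph.localComp, hw, G.diag]
      · by_cases hwv : w = v
        · subst hwv
          rw [presentationRow_self]
          simp [LabeledGraph.localComp, smul_smul, G.symm w u, mul_comm]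
        · rw [presentationRow_of_ne _ _ _ hwv]
          simp [LabeledGraph.localComp, hu, hwv, Ne.symm hw, smul_smul, add_smul]

/-- The vector `A` can be replaced by any other value at `v` that is not parallel to `B v`. -/
lemma Presents.exists_update (h : Presents L c G A B) (v : V) {x : F × F}
    (hx : pairing (B v) x ≠ 0) :
    ∃ H B', LabeledGraph.LocallyEquivalent G H ∧ Presents L c H (Function.update A v x) B' := by
  have hv : pairing (B v) (A v) ≠ 0 := by
    simpa [h.pairing_eq] using h.ne_zero
  obtain ⟨r, hr⟩ := exists_eq_smul_add_smul hv hx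
  have hs := inv_ne_zero (div_ne_zero hx hv)
  have h' := (h.localComp r v).scaleVertex hs v
  rw [inv_inv, Function.update_self, ← hr, Function.update_idem] at h'
  exact ⟨_, _, (LabeledGraph.locallyEquivalent_localComp G r v).trans
    (LabeledGraph.locallyEquivalent_scaleVertex _ hs v), h'⟩

lemma Presents.pairing_ne_zero (h : Presents L c G A B) (v : V) {x : F × F} (hx : x ≠ 0)
    (hBx : pairing (B v) x = 0) : pairing (A v) x ≠ 0 := by
  obtain ⟨t, ht⟩ := exists_smul_eq_of_pairing_eq_zero hBx hx
  intro hAx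
  apply h.ne_zero
  rw [← h.pairing_eq v, ht, pairing_smul_left, pairing_swap, hAx, neg_zero, mul_zero]

/-- Presentations of `L` with the same determinant have locally equivalent graphs. -/
theorem Presents.locallyEquivalent [Fintype V] (hL : IsIsotropicSystem L)
    (h : Presents L c G A B) (h' : Presents L c H A' B') :
    LabeledGraph.LocallyEquivalent G H := by
  classical
  have hA' := h'.isEulerianVector hL
  -- Induction on the number of coordinates where `A` and `A'` differ.
  induction hn : (Finset.univ.filter fun v => A v ≠ A' v).card using Nat.strong_induction_on
    generalizing G A B with
  | _ n ih =>
  subst hn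
  have decrease : ∀ (A₁ : V → F × F) (w : V), A w ≠ A' w → A₁ w = A' w →
      (∀ u, A u = A' u → A₁ u = A' u) →
      (Finset.univ.filter fun v => A₁ v ≠ A' v).card <
        (Finset.univ.filter fun v => A v ≠ A' v).card := by
    intro A₁ w hw hw' hsub
    refine Finset.card_lt_card ((Finset.ssubset_iff_of_subset ?_).2 ⟨w, ?_, ?_⟩)
    · intro u
      simp only [Finset.mem_filter, Finset.mem_univ, true_and]
      exact mt (hsub u)
    · simpa using hw
    · simpa using hw'
  by_cases hD : ∀ v, A v = A' v
  · obtain rfl : A = A' := funext hD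
    rw [(h.unique hL h').1]
    exact .refl
  push Not at hD
  obtain ⟨v, hv⟩ := hD
  by_cases hstep : ∃ w, A w ≠ A' w ∧ pairing (B w) (A' w) ≠ 0
  · obtain ⟨w, hw, hBw⟩ := hstep
    obtain ⟨G₁, B₁, he, h₁⟩ := h.exists_update w hBw
    refine he.trans (ih _ (decrease _ w hw (by simp) fun u hu => ?_) h₁ rfl)
    by_cases huw : u = w
    · simp [huw]
    · simpa [huw] using hu
  push Not at hstep
  -- Otherwise row `v` is orthogonal to `A'` at every coordinate, hence zero, although its entry `B
  -- v` is not.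
  have hedge : ∃ w, A w ≠ A' w ∧ G.label v w ≠ 0 := by
    by_contra! hno
    have hrow : presentationRow G A B v = 0 := by
      refine hA'.eq_zero (h.row_mem v) fun w => ?_
      by_cases hwv : w = v
      · subst hwv
        rw [presentationRow_self, hstep w hv]
      · rw [presentationRow_of_ne _ _ _ hwv, pairing_smul_left]
        by_cases hw : A w = A' w
        · rw [hw, pairing_self, mul_zero]
        · rw [hno w hw, zero_mul]
    apply h.ne_zero
    rw [← h.pairing_eq v, ← presentationRow_self G A B v, hrow, Pi.zero_apply, pairing_zero_left]
  obtain ⟨w, hw, hvw⟩ := hedge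
  -- Local complementation at `v` adds a nonzero multiple of `A w` to `B w`. As `A' w` is orthogonal
  -- to `B w`, it is not orthogonal to `A w`, so `w` is no longer blocked.
  have hBw : pairing (B w + (1 * G.label v w ^ 2) • A w) (A' w) ≠ 0 := by
    rw [pairing_add_left, pairing_smul_left, hstep w hw, zero_add, one_mul]
    exact mul_ne_zero (pow_ne_zero 2 hvw)
      (h.pairing_ne_zero w (hA'.complete w) (hstep w hw))
  obtain ⟨G₁, B₁, he, h₁⟩ := (h.localComp 1 v).exists_update w hBw
  refine ((LabeledGraph.locallyEquivalent_localComp G 1 v).trans he).trans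
    (ih _ (decrease _ w hw (by simp) fun u hu => ?_) h₁ rfl)
  have huw : u ≠ w := fun e => hw (e ▸ hu)
  -- The complementation also changes `A v`, but `v` was already a coordinate of disagreement, so no
  -- agreement is lost.
  have huv : u ≠ v := fun e => hv (e ▸ hu)
  simpa [huw, huv] using hu

/-! ### Fundamental graphs and their presentations -/

section Counting

variable [Fintype V]

lemma IsFundamentalGraph.scale (hL : IsIsotropicSystem L) (hG : IsFundamentalGraph L G) {d : F}
    (hd : d ≠ 0) : IsFundamentalGraph L (G.scale d) := by
  obtain ⟨A, B, h⟩ := hG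
  obtain ⟨c, h⟩ := (isGraphicPresentation_iff hL).1 h
  exact ⟨A, d • B, (isGraphicPresentation_iff hL).2 ⟨_, h.scale hd⟩⟩

lemma IsFundamentalGraph.of_locallyEquivalent (hL : IsIsotropicSystem L)
    (hG : IsFundamentalGraph L G) (h : LabeledGraph.LocallyEquivalent G H) :
    IsFundamentalGraph L H := by
  induction h with
  | refl => exact hG
  | tail _ hs ih =>
    obtain ⟨A, B, h⟩ := ih
    obtain ⟨c, h⟩ := (isGraphicPresentation_iff hL).1 h
    rcases hs with ⟨r, v, rfl⟩ | ⟨s, v, hs, rfl⟩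
    · exact ⟨_, _, (isGraphicPresentation_iff hL).2 ⟨_, h.localComp r v⟩⟩
    · exact ⟨_, _, (isGraphicPresentation_iff hL).2 ⟨_, h.scaleVertex hs v⟩⟩

/-- The fundamental graphs of `L` are the graphs locally equivalent to a multiple of one of
them. -/
lemma isFundamentalGraph_iff (hL : IsIsotropicSystem L) (hG : IsFundamentalGraph L G) :
    IsFundamentalGraph L H ↔
      ∃ c : F, c ≠ 0 ∧ LabeledGraph.LocallyEquivalent (G.scale c) H := by
  constructor
  · rintro ⟨A', B', h'⟩
    obtain ⟨A, B, h⟩ := hG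
    obtain ⟨c, h⟩ := (isGraphicPresentation_iff hL).1 h
    obtain ⟨c', h'⟩ := (isGraphicPresentation_iff hL).1 h'
    have hd := div_ne_zero h'.ne_zero h.ne_zero
    refine ⟨c' / c, hd, ?_⟩
    have h₁ := h.scale hd
    rw [div_mul_cancel₀ _ h.ne_zero] at h₁
    exact h₁.locallyEquivalent hL h'
  · rintro ⟨c, hc, h⟩
    exact (hG.scale hL hc).of_locallyEquivalent hL h

/-- Every nonzero determinant and every Eulerian vector belong to exactly one graphic
presentation. -/
lemma card_graphicPresentations [Nonempty V] (hL : IsIsotropicSystem L) :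
    Nat.card (Σ H : {H : LabeledGraph V F // IsFundamentalGraph L H},
      {P : (V → F × F) × (V → F × F) // IsGraphicPresentation L H.1 P.1 P.2}) =
      Nat.card Fˣ * numEulerianVectors L := by
  rw [numEulerianVectors, ← Nat.card_prod]
  choose c hc using fun (H : LabeledGraph V F) (P : (V → F × F) × (V → F × F))
    (h : IsGraphicPresentation L H P.1 P.2) => (isGraphicPresentation_iff hL).1 h
  refine Nat.card_eq_of_bijective (fun T => (Units.mk0 (c _ _ T.2.2) (hc _ _ T.2.2).ne_zero,
    ⟨T.2.1.1, (hc _ _ T.2.2).isEulerianVector hL⟩)) ⟨?_, ?_⟩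
  · rintro ⟨⟨H, hH⟩, ⟨A, B⟩, h⟩ ⟨⟨H', hH'⟩, ⟨A', B'⟩, h'⟩ e
    simp only [Prod.mk.injEq, Units.mk0_inj, Subtype.mk.injEq] at e
    obtain ⟨e, rfl⟩ := e
    have h₁ := hc _ _ h
    rw [e] at h₁
    obtain ⟨rfl, rfl⟩ := h₁.unique hL (hc _ _ h')
    rfl
  · rintro ⟨d, A, hA⟩
    obtain ⟨H, B, h⟩ := hA.exists_presents hL d.ne_zero
    have hg := (isGraphicPresentation_iff hL).2 ⟨_, h⟩
    refine ⟨⟨⟨H, A, B, hg⟩, ⟨(A, B), hg⟩⟩, ?_⟩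
    simp only [Prod.mk.injEq, and_true]
    ext
    simp only [Units.val_mk0]
    -- The chosen determinant is the given one because it can be read off at any vertex.
    obtain ⟨v⟩ := ‹Nonempty V›
    rw [← (hc H (A, B) hg).pairing_eq v, h.pairing_eq v]

variable [Finite F]

lemma numPresentations_le_of_injective
    (f : (V → F × F) × (V → F × F) → (V → F × F) × (V → F × F)) (hf : Function.Injective f)
    (h : ∀ P, IsGraphicPresentation L G P.1 P.2 →
      IsGraphicPresentation L H (f P).1 (f P).2) :
    numPresentations L G ≤ numPresentations L H :=
  Nat.card_le_card_of_injective (fun P => ⟨f P.1, h P.1 P.2⟩) fun _ _ e =>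
    Subtype.ext (hf (congrArg Subtype.val e))

lemma numPresentations_le_scale (hL : IsIsotropicSystem L) {d : F} (hd : d ≠ 0) :
    numPresentations L G ≤ numPresentations L (G.scale d) := by
  refine numPresentations_le_of_injective (fun P => (P.1, d • P.2)) ?_ ?_
  · rintro ⟨A, B⟩ ⟨A', B'⟩ e
    simp only [Prod.mk.injEq] at e
    rw [e.1, smul_right_injective _ hd e.2]
  · intro P hP
    obtain ⟨c, h⟩ := (isGraphicPresentation_iff hL).1 hP
    exact (isGraphicPresentation_iff hL).2 ⟨_, h.scale hd⟩

lemma numPresentations_le_scaleVertex (hL : IsIsotropicSystem L) {s : F} (hs : s ≠ 0) (v : V) :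
    numPresentations L G ≤ numPresentations L (G.scaleVertex s v) := by
  refine numPresentations_le_of_injective (fun P =>
    (Function.update P.1 v (s⁻¹ • P.1 v), Function.update P.2 v (s • P.2 v))) ?_ ?_
  · have aux : ∀ {t : F}, t ≠ 0 → ∀ {X Y : V → F × F},
        Function.update X v (t • X v) = Function.update Y v (t • Y v) → X = Y := by
      intro t ht X Y e
      ext1 u
      have := congrFun e u
      by_cases hu : u = v
      · subst hu
        rw [Function.update_self, Function.update_self] at this
        exact smul_right_injective _ ht this
      · simpa [hu] using this
    rintro ⟨A, B⟩ ⟨A', B'⟩ e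
    simp only [Prod.mk.injEq] at e
    rw [aux (inv_ne_zero hs) e.1, aux hs e.2]
  · intro P hP
    obtain ⟨c, h⟩ := (isGraphicPresentation_iff hL).1 hP
    exact (isGraphicPresentation_iff hL).2 ⟨_, h.scaleVertex hs v⟩

lemma numPresentations_le_localComp (hL : IsIsotropicSystem L) (r : F) (v : V) :
    numPresentations L G ≤ numPresentations L (G.localComp r v) := by
  refine numPresentations_le_of_injective (fun P =>
    (Function.update P.1 v (P.1 v + r • P.2 v),
      fun u => P.2 u + (r * G.label v u ^ 2) • P.1 u)) ?_ ?_
  · rintro ⟨A, B⟩ ⟨A', B'⟩ e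
    simp only [Prod.mk.injEq] at e
    obtain ⟨e₁, e₂⟩ := e
    -- The zero diagonal leaves `B v` unchanged, so it is recovered before `A`, and `A` before the
    -- rest of `B`.
    have hBv : B v = B' v := by
      simpa [G.diag] using congrFun e₂ v
    have hA : A = A' := by
      ext1 u
      have := congrFun e₁ u
      by_cases hu : u = v
      · subst hu
        simpa [hBv] using this
      · simpa [hu] using this
    subst hA
    have hB : B = B' := by
      ext1 u
      exact add_right_cancel (congrFun e₂ u)
    rw [hB]
  · intro P hP
    obtain ⟨c, h⟩ := (isGraphicPresentation_iff hL).1 hP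
    exact (isGraphicPresentation_iff hL).2 ⟨_, h.localComp r v⟩

lemma numPresentations_le_of_locallyEquivalent (hL : IsIsotropicSystem L)
    (h : LabeledGraph.LocallyEquivalent G H) : numPresentations L G ≤ numPresentations L H := by
  induction h with
  | refl => exact le_rfl
  | tail _ hs ih =>
    rcases hs with ⟨r, v, rfl⟩ | ⟨s, v, hs, rfl⟩
    · exact ih.trans (numPresentations_le_localComp hL r v)
    · exact ih.trans (numPresentations_le_scaleVertex hL hs v)

lemma numPresentations_eq (hL : IsIsotropicSystem L) (hG : IsFundamentalGraph L G)
    (hH : IsFundamentalGraph L H) : numPresentations L G = numPresentations L H := by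
  -- One inequality is enough: any two fundamental graphs are each locally equivalent to a multiple
  -- of the other.
  have key : ∀ {G H : LabeledGraph V F}, IsFundamentalGraph L G → IsFundamentalGraph L H →
      numPresentations L G ≤ numPresentations L H := by
    intro G H hG hH
    obtain ⟨c, hc, h⟩ := (isFundamentalGraph_iff hL hG).1 hH
    exact (numPresentations_le_scale hL hc).trans (numPresentations_le_of_locallyEquivalent hL h)
  exact le_antisymm (key hG hH) (key hH hG)

lemma numPresentations_eq_index (hL : IsIsotropicSystem L) (hG : IsFundamentalGraph L G) :
    numPresentations L G = index L := by
  have hex : ∃ G : LabeledGraph V F, IsFundamentalGraph L G := ⟨G, hG⟩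
  rw [index, dif_pos hex]
  exact numPresentations_eq hL hG hex.choose_spec

lemma IsFundamentalGraph.numPresentations_pos (hG : IsFundamentalGraph L G) :
    0 < numPresentations L G := by
  obtain ⟨A, B, h⟩ := hG
  have : Nonempty {P : (V → F × F) × (V → F × F) // IsGraphicPresentation L G P.1 P.2} :=
    ⟨⟨(A, B), h⟩⟩
  exact Nat.card_pos

/-- Presentations are fibred over fundamental graphs, with all fibres of size `index L`. -/
theorem numLocallyEquivalentToMultiple_mul_index [Nonempty V] (hL : IsIsotropicSystem L)
    (hG : IsFundamentalGraph L G) :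
    G.numLocallyEquivalentToMultiple * index L = Nat.card Fˣ * numEulerianVectors L := by
  classical
  have := Fintype.ofFinite {H : LabeledGraph V F // IsFundamentalGraph L H}
  have hN : G.numLocallyEquivalentToMultiple =
      Nat.card {H : LabeledGraph V F // IsFundamentalGraph L H} :=
    Nat.card_congr (Equiv.subtypeEquivRight fun H => (isFundamentalGraph_iff hL hG).symm)
  rw [hN, ← card_graphicPresentations hL, Nat.card_sigma, Nat.card_eq_fintype_card,
    ← smul_eq_mul, ← Finset.card_univ, ← Finset.sum_const]
  exact Finset.sum_congr rfl fun H _ => (numPresentations_eq_index hL H.2).symm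

end Counting

end IsoSys

theorem mainTheorem3 {V F : Type*} [Fintype V] [DecidableEq V] [Nonempty V]
    [Field F] [Fintype F] (L : Submodule F (V → F × F)) (hL : IsoSys.IsIsotropicSystem L)
    (G : IsoSys.LabeledGraph V F) (hG : IsoSys.IsFundamentalGraph L G) :
    (∀ H : IsoSys.LabeledGraph V F, IsoSys.IsFundamentalGraph L H →
      IsoSys.numPresentations L H = IsoSys.index L) ∧
    0 < IsoSys.index L ∧
    (G.numLocallyEquivalentToMultiple : ℚ) =
      ((Fintype.card F : ℚ) - 1) * (IsoSys.numEulerianVectors L : ℚ) / (IsoSys.index L : ℚ) ∧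
    ((G.numLocallyEquivalent : ℚ) =
        ((Fintype.card F : ℚ) - 1) * (IsoSys.numEulerianVectors L : ℚ) / (IsoSys.index L : ℚ) ∨
      2 * (G.numLocallyEquivalent : ℚ) =
        ((Fintype.card F : ℚ) - 1) * (IsoSys.numEulerianVectors L : ℚ) / (IsoSys.index L : ℚ)) := by
  have hpos : 0 < IsoSys.index L := by
    rw [← IsoSys.numPresentations_eq_index hL hG]
    exact hG.numPresentations_pos
  have hmain : (G.numLocallyEquivalentToMultiple : ℚ) =
      ((Fintype.card F : ℚ) - 1) * (IsoSys.numEulerianVectors L : ℚ) / (IsoSys.index L : ℚ) := by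
    have h := IsoSys.numLocallyEquivalentToMultiple_mul_index hL hG
    rw [Nat.card_units, Nat.card_eq_fintype_card] at h
    rw [eq_div_iff (by exact_mod_cast hpos.ne'), ← Nat.cast_one (R := ℚ),
      ← Nat.cast_sub Fintype.card_pos]
    exact_mod_cast h
  refine ⟨fun H hH => IsoSys.numPresentations_eq_index hL hH, hpos, hmain, ?_⟩
  rw [← hmain]
  exact G.numLocallyEquivalentToMultiple_eq.imp (fun h => by exact_mod_cast h)
    (fun h => by exact_mod_cast h)
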